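/- Conventions. A geodesic path from $x$ to $y$ in a metric space $(X,d)$ is a map $c:[0,l]\to X$ with $l=d(x,y)$, $c(0)=x$, $c(l)=y$ and $d(c(s),c(t))=|s-t|$ for all $s,t\in[0,l]$. A CAT(1) space is a metric space in which any two points at distance less than $\pi$ are joined by a geodesic path and every geodesic triangle of perimeter less than $2\pi$ satisfies the comparison inequality $d(p,q)\le\rho(\bar p,\bar q)$ with respect to its comparison triangles in the unit sphere $\mathbb S^2$ with the spherical metric $\rho$; it is admissible if $d(w,w')<\pi/2$ for all $w,w'\in X$. In an admissible CAT(1) space the geodesic path $c$ from $x$ to $y$ is unique, and $\alpha x\oplus(1-\alpha)y:=c((1-\alpha)d(x,y))$ for $\alpha\in[0,1]$. A function $f:X\to(-\infty,\infty]$ is proper if it is not identically $\infty$, and convex if $f(\alpha x\oplus(1-\alpha)y)\le\alpha f(x)+(1-\alpha)f(y)$ for all $x,y\in X$, $\alpha\in(0,1)$; $\operatorname{Argmin} f$ is the set of its minimizers. If $X$ is also complete and $f$ is proper, lower semicontinuous and convex, then for $\eta>0$ the resolvent $R_{\eta f}:X\to X$ sends $x$ to the unique minimizer of $y\mapsto \eta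 f(y)+\tan d(y,x)\,\sin d(y,x)$. A sequence $\{u_n\}$ in $X$ is spherically bounded if $\inf_{y\in X}\limsup_{n}d(y,u_n)<\pi/2$; its asymptotic center is the set of all $z\in X$ with $\limsup_n d(z,u_n)=\inf_{y\in X}\limsup_n d(y,u_n)$; it is $\Delta$-convergent to $p\in X$ if every subsequence of it has asymptotic center $\{p\}$. Theorem 4.1. Let $X$ be an admissible complete CAT(1) space and $f:X\to(-\infty,\infty]$ a proper lower semicontinuous convex function. Let $\{\alpha_n\}$ be a sequence in $[0,1)$ and $\{\lambda_n\}$ a sequence of positive real numbers with $\sum_{n=1}^\infty(1-\alpha_n)\lambda_n=\infty$, and let $\{x_n\}$ be defined by $x_1\in X$ and $$x_{n+1}=\alpha_n x_n\oplus(1-\alpha_n)R_{\lambda_n f}x_n\qquad(n=1,2,\dots).$$ Then the following hold. (i) $\operatorname{Argmin} f\neq\emptyset$ if and only if $\{R_{\lambda_n f}x_n\}$ is spherically bounded and $\sup_n d(R_{\lambda_n f}x_n,x_n)<\pi/2$. (ii) If $\operatorname{Argmin} f\neq\emptyset$ and $\sup_n\alpha_n<1$, then there is $x_\infty\in\operatorname{Argmin}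 f$ such that both $\{x_n\}$ and $\{R_{\lambda_n f}x_n\}$ are $\Delta$-convergent to $x_\infty$. -/

import Mathlib

open Filter Topology

namespace CATOne

/-- `c`, restricted to `[0, ρ x y]`, is a geodesic path from `x` to `y` for the distance function
`ρ`. -/
def IsGeodesicPath {Y : Type*} (ρ : Y → Y → ℝ) (c : ℝ → Y) (x y : Y) : Prop :=
  c 0 = x ∧ c (ρ x y) = y ∧
    ∀ s ∈ Set.Icc 0 (ρ x y), ∀ t ∈ Set.Icc 0 (ρ x y), ρ (c s) (c t) = |s - t|

/-- The unit sphere of three dimensional Euclidean space. -/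
abbrev Sphere2 : Type := Metric.sphere (0 : EuclideanSpace ℝ (Fin 3)) 1

/-- The spherical (angular) distance on the unit sphere. -/
noncomputable def sphericalDist (u v : Sphere2) : ℝ :=
  Real.arccos (inner ℝ (u : EuclideanSpace ℝ (Fin 3)) (v : EuclideanSpace ℝ (Fin 3)))

/-- CAT(1) spaces. The three sides of a geodesic triangle with vertices `x 0, x 1, x 2` are the
geodesic paths `c i` from `x i` to `x (i + 1)` (indices modulo 3), and those of the comparison
triangle are the paths `c' i` from `x' i` to `x' (i + 1)`. The comparison point of `c i s` is the
point `c' i s`, which lies on the corresponding side at the same distance `s` from `x' i`. -/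
structure IsCAT1 (X : Type*) [MetricSpace X] : Prop where
  exists_geodesic : ∀ x y : X, dist x y < Real.pi → ∃ c : ℝ → X, IsGeodesicPath dist c x y
  comparison : ∀ (x : Fin 3 → X) (c : Fin 3 → ℝ → X) (x' : Fin 3 → Sphere2)
    (c' : Fin 3 → ℝ → Sphere2),
    dist (x 0) (x 1) + dist (x 1) (x 2) + dist (x 2) (x 0) < 2 * Real.pi →
    (∀ i, IsGeodesicPath dist (c i) (x i) (x (i + 1))) →
    (∀ i j, dist (x i) (x j) = sphericalDist (x' i) (x' j)) →
    (∀ i, IsGeodesicPath sphericalDist (c' i) (x' i) (x' (i + 1))) →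
    ∀ i j, ∀ s ∈ Set.Icc 0 (dist (x i) (x (i + 1))), ∀ t ∈ Set.Icc 0 (dist (x j) (x (j + 1))),
      dist (c i s) (c j t) ≤ sphericalDist (c' i s) (c' j t)

/-- Any two points are at distance less than `π / 2`. -/
def IsAdmissible (X : Type*) [MetricSpace X] : Prop :=
  ∀ w w' : X, dist w w' < Real.pi / 2

section

variable {X : Type*} [MetricSpace X]

/-- `p` is the point `a x ⊕ (1 - a) y`, at distance `(1 - a) d(x, y)` from `x` on a geodesic path
from `x` to `y` (the path is unique in a CAT(1) space if `d(x, y) < π`). -/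
def IsCombination (a : ℝ) (x y p : X) : Prop :=
  ∃ c : ℝ → X, IsGeodesicPath dist c x y ∧ p = c ((1 - a) * dist x y)

/-- The proper lower semicontinuous convex functions from `X` into `(-∞, ∞]`
(for an admissible CAT(1) space `X`). -/
structure IsGammaZero (f : X → EReal) : Prop where
  ne_bot : ∀ x, f x ≠ ⊥
  proper : ∃ a, f a ≠ ⊤
  lowerSemicontinuous : LowerSemicontinuous f
  convex : ∀ (x y p : X) (a : ℝ), 0 < a → a < 1 → IsCombination a x y p →
    f p ≤ (a : EReal) * f x + ((1 - a : ℝ) : EReal) * f y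

/-- The set of all minimizers of `f`. -/
def argmin (f : X → EReal) : Set X := {p | ∀ y, f p ≤ f y}

/-- The resolvent of `f`: the minimizer of `y ↦ f y + tan d(y, x) sin d(y, x)`. -/
noncomputable def resolvent (f : X → EReal) (x : X) : X :=
  @Classical.epsilon X ⟨x⟩ fun z =>
    z ∈ argmin fun y => f y + ((Real.tan (dist y x) * Real.sin (dist y x) : ℝ) : EReal)

/-- The asymptotic center of a sequence. -/
def asymptoticCenter (x : ℕ → X) : Set X :=
  {z | limsup (fun n => edist z (x n)) atTop = ⨅ y : X, limsup (fun n => edist y (x n)) atTop}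

/-- `x` is `Δ`-convergent to `p`: every subsequence has asymptotic center `{p}`. -/
def DeltaTendsto (x : ℕ → X) (p : X) : Prop :=
  ∀ φ : ℕ → ℕ, StrictMono φ → asymptoticCenter (x ∘ φ) = {p}

/-- Spherical boundedness of a sequence. -/
def SphericallyBounded (x : ℕ → X) : Prop :=
  (⨅ y : X, limsup (fun n => edist y (x n)) atTop) < ENNReal.ofReal (Real.pi / 2)

end

end CATOne

/-! In an admissible space all cosines of distances are positive, and comparison with the sphere
makes `cos (dist · w)` concave along geodesics, with a gain of the factor `cos (dist x y / 2)` at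
midpoints. By completeness this gain produces both the resolvents and the asymptotic centers, the
latter as maximizers of `liminfCos`.

Testing the minimality of `z = resolvent f x` along the geodesic from `z` to `y` gives
`resolvent_inequality`. If `f y ≤ f z`, it reduces to `cos d(y,x) ≤ cos d(z,x) * cos d(y,z)`, so for
a minimizer `v` the numbers `cos d(v, x n)` increase, which gives both bounds in (i). Conversely, if
`d(z n, x n)` stays away from `π / 2`, the inequality telescopes, and divergence of the weights
forces `f (z n)` below each level above the infimum infinitely often (`frequently_lt`). The
asymptotic center of a subsequence of `z` along which the values tend to the infimum lies in all
these sublevel sets by `mem_of_forall_liminfCos_le`, hence is a minimizer.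

In (ii), `d(z n, x n)` tends to 0, and the whole sequence `x` approaches each sublevel set even
though `f (z n)` is controlled only infinitely often (`exists_tendsto_sublevel`). So every
subsequence of `x` has its center in `argmin f`. There `liminfCos` is the same for all subsequences,
because `cos d(v, x n)` converges, and the centers coincide. -/

namespace CATOne

/-! ### Geodesics and triangles on the unit sphere -/

section Sphere

theorem Sphere2.inner_self (u : Sphere2) :
    inner ℝ (u : EuclideanSpace ℝ (Fin 3)) (u : EuclideanSpace ℝ (Fin 3)) = 1 := by
  rw [real_inner_self_eq_norm_sq, norm_eq_of_mem_sphere]; norm_num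

theorem cos_sphericalDist (u v : Sphere2) :
    Real.cos (sphericalDist u v) =
      inner ℝ (u : EuclideanSpace ℝ (Fin 3)) (v : EuclideanSpace ℝ (Fin 3)) := by
  have h := abs_real_inner_le_norm (u : EuclideanSpace ℝ (Fin 3)) (v : EuclideanSpace ℝ (Fin 3))
  rw [norm_eq_of_mem_sphere, norm_eq_of_mem_sphere, one_mul, abs_le] at h
  exact Real.cos_arccos h.1 h.2

theorem sphericalDist_eq_of_inner {u v : Sphere2} {t : ℝ} (h0 : 0 ≤ t) (h1 : t ≤ Real.pi)
    (h : inner ℝ (u : EuclideanSpace ℝ (Fin 3)) (v : EuclideanSpace ℝ (Fin 3)) = Real.cos t) :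
    sphericalDist u v = t := by
  rw [sphericalDist, h, Real.arccos_cos h0 h1]

theorem sphericalDist_comm (u v : Sphere2) : sphericalDist u v = sphericalDist v u := by
  rw [sphericalDist, sphericalDist, real_inner_comm]

theorem sphericalDist_self (u : Sphere2) : sphericalDist u u = 0 :=
  sphericalDist_eq_of_inner le_rfl Real.pi_pos.le (by rw [Sphere2.inner_self, Real.cos_zero])

/-- Points of the sphere at distance less than `π` are joined by an explicit geodesic path. -/
theorem exists_sphere_geodesic (u v : Sphere2) (h : sphericalDist u v < Real.pi) :
    ∃ c : ℝ → Sphere2, IsGeodesicPath sphericalDist c u v ∧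
      ∀ s ∈ Set.Icc 0 (sphericalDist u v), ∀ w : Sphere2,
        Real.sin (sphericalDist u v) * Real.cos (sphericalDist (c s) w) =
          Real.sin (sphericalDist u v - s) * Real.cos (sphericalDist u w) +
            Real.sin s * Real.cos (sphericalDist v w) := by
  set l := sphericalDist u v with hl
  have hl0 : 0 ≤ l := Real.arccos_nonneg _
  have huv := cos_sphericalDist u v
  rw [← hl] at huv
  have huu := Sphere2.inner_self u
  have hvv := Sphere2.inner_self v
  rcases hl0.eq_or_lt with h0 | hpos
  · rw [← h0, Real.cos_zero] at huv
    have e : u = v := Subtype.ext ((inner_eq_one_iff_of_norm_eq_one (norm_eq_of_mem_sphere u)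
      (norm_eq_of_mem_sphere v)).1 huv.symm)
    refine ⟨fun _ => u, ⟨rfl, e, ?_⟩, ?_⟩
    · intro s hs t ht
      rw [← hl, ← h0, Set.mem_Icc] at hs ht
      have hs' : s = 0 := le_antisymm hs.2 hs.1
      have ht' : t = 0 := le_antisymm ht.2 ht.1
      simp [hs', ht', sphericalDist_self]
    · intro s hs w
      rw [← h0, Set.mem_Icc] at hs
      have hs' : s = 0 := le_antisymm hs.2 hs.1
      simp [hs', ← h0]
  · have hsin : 0 < Real.sin l := Real.sin_pos_of_pos_of_lt_pi hpos h
    have hsc := Real.sin_sq_add_cos_sq l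
    -- Gram-Schmidt: `e` is the unit tangent vector at `u` pointing towards `v`, and the geodesic is
    -- `cos s • u + sin s • e`.
    let e : EuclideanSpace ℝ (Fin 3) :=
      (Real.sin l)⁻¹ • ((v : EuclideanSpace ℝ (Fin 3)) - Real.cos l • (u : EuclideanSpace ℝ (Fin 3)))
    have hue : inner ℝ (u : EuclideanSpace ℝ (Fin 3)) e = 0 := by
      simp only [e, inner_smul_right, inner_sub_right, huu, ← huv]; ring
    have hee : inner ℝ e e = 1 := by
      simp only [e, inner_smul_right, inner_smul_left, inner_sub_right, inner_sub_left, huu, hvv,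
        ← huv, real_inner_comm (u : EuclideanSpace ℝ (Fin 3)) (v : EuclideanSpace ℝ (Fin 3))]
      simp only [conj_trivial]
      field_simp
      linarith
    have hin : ∀ s t : ℝ, inner ℝ (Real.cos s • (u : EuclideanSpace ℝ (Fin 3)) + Real.sin s • e)
        (Real.cos t • (u : EuclideanSpace ℝ (Fin 3)) + Real.sin t • e) = Real.cos (s - t) := by
      intro s t
      simp only [inner_add_left, inner_add_right, inner_smul_left, inner_smul_right, huu, hue, hee,
        real_inner_comm (u : EuclideanSpace ℝ (Fin 3)) e, conj_trivial, Real.cos_sub]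
      ring
    have hmem : ∀ s : ℝ, Real.cos s • (u : EuclideanSpace ℝ (Fin 3)) + Real.sin s • e ∈
        Metric.sphere (0 : EuclideanSpace ℝ (Fin 3)) 1 := by
      intro s
      have := hin s s
      rw [sub_self, Real.cos_zero, real_inner_self_eq_norm_sq] at this
      rw [mem_sphere_zero_iff_norm]
      nlinarith [norm_nonneg (Real.cos s • (u : EuclideanSpace ℝ (Fin 3)) + Real.sin s • e)]
    refine ⟨fun s => ⟨_, hmem s⟩, ⟨?_, ?_, ?_⟩, ?_⟩
    · ext1; simp
    · ext1
      simp only [← hl, e, smul_smul, mul_inv_cancel₀ hsin.ne', one_smul]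
      abel
    · intro s hs t ht
      rw [← hl, Set.mem_Icc] at hs ht
      refine sphericalDist_eq_of_inner (abs_nonneg _) ?_ ?_
      · rw [abs_le]; constructor <;> linarith
      · rw [Real.cos_abs]; exact hin s t
    · intro s _ w
      rw [cos_sphericalDist, cos_sphericalDist, cos_sphericalDist]
      simp only [e, inner_add_left, inner_smul_left, inner_sub_left, conj_trivial, Real.sin_sub]
      field_simp
      ring

/-- Comparison triangles on the sphere. -/
theorem exists_sphere_triangle {l a b : ℝ} (hl : 0 < l) (ha0 : 0 ≤ a) (hb0 : 0 ≤ b)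
    (hla : l + a ≤ Real.pi) (hb : b ≤ Real.pi)
    (h1 : b ≤ l + a) (h2 : l ≤ a + b) (h3 : a ≤ l + b) :
    ∃ u v w : Sphere2, sphericalDist u v = l ∧ sphericalDist u w = a ∧ sphericalDist v w = b := by
  -- If `a = 0`, then `l = π` is allowed and `sin l` may vanish; otherwise `l < π`.
  rcases ha0.eq_or_lt with rfl | hapos
  · have e : b = l := by linarith
    subst e
    let u : EuclideanSpace ℝ (Fin 3) := !₂[1, 0, 0]
    let v : EuclideanSpace ℝ (Fin 3) := !₂[Real.cos b, Real.sin b, 0]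
    have hu : u ∈ Metric.sphere (0 : EuclideanSpace ℝ (Fin 3)) 1 := by
      simp [u, EuclideanSpace.norm_eq, Fin.sum_univ_three]
    have hv : v ∈ Metric.sphere (0 : EuclideanSpace ℝ (Fin 3)) 1 := by
      simp [v, EuclideanSpace.norm_eq, Fin.sum_univ_three]
    have huv : sphericalDist ⟨u, hu⟩ ⟨v, hv⟩ = b := by
      refine sphericalDist_eq_of_inner hb0 hb ?_
      simp [u, v, PiLp.inner_apply, Fin.sum_univ_three]
    exact ⟨⟨u, hu⟩, ⟨v, hv⟩, ⟨u, hu⟩, huv, sphericalDist_self _, by rw [sphericalDist_comm, huv]⟩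
  have hsin : 0 < Real.sin l := Real.sin_pos_of_pos_of_lt_pi hl (by linarith)
  have hsina : 0 < Real.sin a := Real.sin_pos_of_pos_of_lt_pi hapos (by linarith)
  have c1 : Real.cos (l + a) ≤ Real.cos b := Real.cos_le_cos_of_nonneg_of_le_pi hb0 hla h1
  have c2 : Real.cos b ≤ Real.cos (l - a) := by
    rw [← Real.cos_abs (l - a)]
    refine Real.cos_le_cos_of_nonneg_of_le_pi (abs_nonneg _) hb ?_
    rw [abs_le]; constructor <;> linarith
  rw [Real.cos_add] at c1
  rw [Real.cos_sub] at c2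
  -- The second coordinate of `w`, forced by `⟪v, w⟫ = cos b`. The triangle inequalities amount to
  -- `|k| ≤ sin a`, which leaves room for a third coordinate.
  set k := (Real.cos b - Real.cos a * Real.cos l) / Real.sin l with hk
  have hkl : Real.cos l * Real.cos a + Real.sin l * k = Real.cos b := by
    rw [hk]; field_simp; ring
  have hk2 : Real.cos a ^ 2 + k ^ 2 ≤ 1 := by
    have k1 : k ≤ Real.sin a := by
      rw [hk, div_le_iff₀ hsin]; nlinarith
    have k2 : -Real.sin a ≤ k := by
      rw [hk, le_div_iff₀ hsin]; nlinarith
    nlinarith [Real.sin_sq_add_cos_sq a]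
  let u : EuclideanSpace ℝ (Fin 3) := !₂[1, 0, 0]
  let v : EuclideanSpace ℝ (Fin 3) := !₂[Real.cos l, Real.sin l, 0]
  let w : EuclideanSpace ℝ (Fin 3) := !₂[Real.cos a, k, √(1 - Real.cos a ^ 2 - k ^ 2)]
  have hu : u ∈ Metric.sphere (0 : EuclideanSpace ℝ (Fin 3)) 1 := by
    simp [u, EuclideanSpace.norm_eq, Fin.sum_univ_three]
  have hv : v ∈ Metric.sphere (0 : EuclideanSpace ℝ (Fin 3)) 1 := by
    simp [v, EuclideanSpace.norm_eq, Fin.sum_univ_three]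
  have hw : w ∈ Metric.sphere (0 : EuclideanSpace ℝ (Fin 3)) 1 := by
    have : 0 ≤ 1 - Real.cos a ^ 2 - k ^ 2 := by linarith
    simp [w, EuclideanSpace.norm_eq, Fin.sum_univ_three, Real.sq_sqrt this]
  refine ⟨⟨u, hu⟩, ⟨v, hv⟩, ⟨w, hw⟩, ?_, ?_, ?_⟩
  · refine sphericalDist_eq_of_inner hl.le (by linarith) ?_
    simp [u, v, PiLp.inner_apply, Fin.sum_univ_three]
  · refine sphericalDist_eq_of_inner ha0 (by linarith) ?_
    simp [u, w, PiLp.inner_apply, Fin.sum_univ_three]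
  · refine sphericalDist_eq_of_inner hb0 hb ?_
    rw [← hkl]
    simp [v, w, PiLp.inner_apply, Fin.sum_univ_three]
    ring

end Sphere

/-! ### Cosine comparison inequalities in admissible CAT(1) spaces -/

section

variable {X : Type*} [MetricSpace X]

theorem IsAdmissible.cos_pos (hadm : IsAdmissible X) (x y : X) : 0 < Real.cos (dist x y) :=
  Real.cos_pos_of_mem_Ioo
    ⟨by linarith [Real.pi_pos, dist_nonneg (x := x) (y := y)], hadm x y⟩

/-- The comparison inequality for a vertex and a point on the opposite side, in terms of
cosines. -/
theorem IsCAT1.cos_dist_geodesic (hcat : IsCAT1 X) (hadm : IsAdmissible X) {x y : X} (w : X)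
    {c : ℝ → X} (hc : IsGeodesicPath dist c x y) {s : ℝ} (hs : s ∈ Set.Icc 0 (dist x y)) :
    Real.cos (dist x w) * Real.sin (dist x y - s) + Real.cos (dist y w) * Real.sin s ≤
      Real.cos (dist (c s) w) * Real.sin (dist x y) := by
  have hpi := Real.pi_pos
  rcases (dist_nonneg (x := x) (y := y)).eq_or_lt with h0 | hpos
  · rw [← h0] at hs ⊢
    have : s = 0 := le_antisymm hs.2 hs.1
    simp [this]
  have a1 := hadm x y
  have a2 := hadm x w
  have a3 := hadm y w
  have t1 := dist_triangle y x w
  have t2 := dist_triangle x w y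
  have t3 := dist_triangle x y w
  rw [dist_comm y x] at t1
  rw [dist_comm w y] at t2
  obtain ⟨u, v, q, huv, huq, hvq⟩ := exists_sphere_triangle (l := dist x y) (a := dist x w)
    (b := dist y w) hpos dist_nonneg dist_nonneg (by linarith) (by linarith) t1 t2 t3
  obtain ⟨d1, hd1⟩ := hcat.exists_geodesic y w (by linarith)
  obtain ⟨d2, hd2⟩ := hcat.exists_geodesic w x (by rw [dist_comm]; linarith)
  obtain ⟨e0, he0, he0'⟩ := exists_sphere_geodesic u v (by linarith)
  obtain ⟨e1, he1, -⟩ := exists_sphere_geodesic v q (by linarith)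
  obtain ⟨e2, he2, -⟩ := exists_sphere_geodesic q u (by rw [sphericalDist_comm]; linarith)
  -- Side 2 runs from `w` to `x`, so its point at parameter 0 is the vertex `w`.
  have key := hcat.comparison ![x, y, w] ![c, d1, d2] ![u, v, q] ![e0, e1, e2]
    (by simp only [Matrix.cons_val]; rw [dist_comm w x]; linarith)
    (by intro i; fin_cases i
        · exact hc
        · exact hd1
        · exact hd2)
    (by
      intro i j
      fin_cases i <;> fin_cases j <;>
        simp [sphericalDist_self, huv, huq, hvq, dist_comm y x, dist_comm w x, dist_comm w y,
          sphericalDist_comm v u, sphericalDist_comm q u, sphericalDist_comm q v])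
    (by intro i; fin_cases i
        · exact he0
        · exact he1
        · exact he2)
    0 2 s hs 0 ⟨le_rfl, dist_nonneg⟩
  have key' : dist (c s) w ≤ sphericalDist (e0 s) q := by
    have := key
    simp only [Matrix.cons_val] at this
    rwa [hd2.1, he2.1] at this
  have := he0' s (by rwa [huv]) q
  rw [huv, huq, hvq] at this
  have hsin : 0 < Real.sin (dist x y) := Real.sin_pos_of_pos_of_lt_pi hpos (by linarith)
  have hcos : Real.cos (sphericalDist (e0 s) q) ≤ Real.cos (dist (c s) w) :=
    Real.cos_le_cos_of_nonneg_of_le_pi dist_nonneg (Real.arccos_le_pi _) key'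
  nlinarith

variable {a : ℝ} {x y p : X}

theorem IsCombination.cos_dist (hcat : IsCAT1 X) (hadm : IsAdmissible X)
    (h : IsCombination a x y p) (ha : a ∈ Set.Icc (0 : ℝ) 1) (w : X) :
    Real.cos (dist x w) * Real.sin (a * dist x y) +
        Real.cos (dist y w) * Real.sin ((1 - a) * dist x y) ≤
      Real.cos (dist p w) * Real.sin (dist x y) := by
  obtain ⟨c, hc, rfl⟩ := h
  have hd := dist_nonneg (x := x) (y := y)
  have := hcat.cos_dist_geodesic hadm w hc (s := (1 - a) * dist x y)
    ⟨mul_nonneg (by linarith [ha.2]) hd, by nlinarith [ha.1]⟩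
  rwa [show dist x y - (1 - a) * dist x y = a * dist x y by ring] at this

theorem IsCombination.eq_of_dist_eq_zero (h : IsCombination a x y p) (h0 : dist x y = 0) :
    p = x := by
  obtain ⟨c, hc, rfl⟩ := h
  rw [h0, mul_zero, hc.1]

theorem mul_sin_le_sin_mul {a t : ℝ} (ha : a ∈ Set.Icc (0 : ℝ) 1) (ht : 0 ≤ t)
    (ht' : t ≤ Real.pi) : a * Real.sin t ≤ Real.sin (a * t) := by
  have := strictConcaveOn_sin_Icc.concaveOn.2
    (show (0 : ℝ) ∈ Set.Icc 0 Real.pi from ⟨le_rfl, Real.pi_pos.le⟩)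
    (show t ∈ Set.Icc 0 Real.pi from ⟨ht, ht'⟩) (sub_nonneg.2 ha.2) ha.1 (by ring)
  simpa using this

/-- Concavity of the sine bounds the weights `sin (a * D) / sin D` of `cos_dist` below by `a`. -/
theorem IsCombination.combination_cos_dist_le (hcat : IsCAT1 X) (hadm : IsAdmissible X)
    (h : IsCombination a x y p) (ha : a ∈ Set.Icc (0 : ℝ) 1) (w : X) :
    a * Real.cos (dist x w) + (1 - a) * Real.cos (dist y w) ≤ Real.cos (dist p w) := by
  rcases (dist_nonneg (x := x) (y := y)).eq_or_lt with h0 | hpos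
  · rw [h.eq_of_dist_eq_zero h0.symm, ← dist_eq_zero.1 h0.symm]
    linarith
  have h1 := hadm x y
  have hsin : 0 < Real.sin (dist x y) :=
    Real.sin_pos_of_pos_of_lt_pi hpos (by linarith [Real.pi_pos])
  have m1 := mul_sin_le_sin_mul ha hpos.le (by linarith [Real.pi_pos])
  have m2 := mul_sin_le_sin_mul (a := 1 - a) ⟨by linarith [ha.2], by linarith [ha.1]⟩ hpos.le
    (by linarith [Real.pi_pos])
  have := h.cos_dist hcat hadm ha w
  have n1 := mul_le_mul_of_nonneg_left m1 (hadm.cos_pos x w).le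
  have n2 := mul_le_mul_of_nonneg_left m2 (hadm.cos_pos y w).le
  refine le_of_mul_le_mul_right ?_ hsin
  linarith

/-- The factor `cos (dist x y / 2)`, from the double angle formula, is the strict convexity behind
all existence and uniqueness arguments below. -/
theorem IsCombination.midpoint_cos_dist (hcat : IsCAT1 X) (hadm : IsAdmissible X)
    (h : IsCombination (1 / 2) x y p) (w : X) :
    Real.cos (dist x w) + Real.cos (dist y w) ≤
      2 * Real.cos (dist x y / 2) * Real.cos (dist p w) := by
  rcases (dist_nonneg (x := x) (y := y)).eq_or_lt with h0 | hpos
  · rw [h.eq_of_dist_eq_zero h0.symm, ← h0, ← dist_eq_zero.1 h0.symm]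
    simp; linarith
  have h1 := hadm x y
  have hsin : 0 < Real.sin (dist x y / 2) :=
    Real.sin_pos_of_pos_of_lt_pi (by linarith) (by linarith [Real.pi_pos])
  have := h.cos_dist hcat hadm ⟨by norm_num, by norm_num⟩ w
  rw [show (1 - 1 / 2 : ℝ) * dist x y = dist x y / 2 by ring,
    show (1 / 2 : ℝ) * dist x y = dist x y / 2 by ring] at this
  have e : Real.sin (dist x y) = 2 * Real.sin (dist x y / 2) * Real.cos (dist x y / 2) := by
    rw [← Real.sin_two_mul]; congr 1; ring
  rw [e] at this
  refine le_of_mul_le_mul_right ?_ hsin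
  linarith

theorem IsCAT1.exists_combination (hcat : IsCAT1 X) (hadm : IsAdmissible X) (a : ℝ) (x y : X) :
    ∃ p, IsCombination a x y p := by
  obtain ⟨c, hc⟩ := hcat.exists_geodesic x y (by linarith [hadm x y, Real.pi_pos])
  exact ⟨_, c, hc, rfl⟩

theorem IsCombination.dist_left (h : IsCombination a x y p) (ha : a ∈ Set.Icc (0 : ℝ) 1) :
    dist x p = (1 - a) * dist x y := by
  obtain ⟨c, hc, rfl⟩ := h
  have hd := dist_nonneg (x := x) (y := y)
  have h0 : 0 ≤ (1 - a) * dist x y := mul_nonneg (by linarith [ha.2]) hd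
  have := hc.2.2 0 ⟨le_rfl, hd⟩ ((1 - a) * dist x y) ⟨h0, by nlinarith [ha.1]⟩
  rw [hc.1] at this
  rw [this, zero_sub, abs_neg, abs_of_nonneg h0]

/-- The bound `1 - cos t ≥ 2 / π ^ 2 * t ^ 2` turns midpoint gains into distances. It serves
minimizing sequences for the resolvent and maximizing sequences for `liminfCos`. -/
theorem cauchySeq_of_cos_half_dist (hadm : IsAdmissible X) {u : ℕ → X} {K : ℝ}
    (h : ∀ k l, k ≤ l → 1 - Real.cos (dist (u k) (u l) / 2) ≤ K / (k + 1)) : CauchySeq u := by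
  have hlim : Tendsto (fun k : ℕ => √(2 * Real.pi ^ 2 * (K / (k + 1)))) atTop (𝓝 0) := by
    have h1 : Tendsto (fun k : ℕ => K / ((k : ℝ) + 1)) atTop (𝓝 0) := by
      have := (tendsto_one_div_add_atTop_nhds_zero_nat (𝕜 := ℝ)).const_mul K
      simpa only [mul_one_div, mul_zero] using this
    have := (h1.const_mul (2 * Real.pi ^ 2)).sqrt
    simpa using this
  refine cauchySeq_of_le_tendsto_0' _ (fun k l hkl => ?_) hlim
  have hd := dist_nonneg (x := u k) (y := u l)
  have hq := Real.cos_le_one_sub_mul_cos_sq (x := dist (u k) (u l) / 2) (by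
    rw [abs_of_nonneg (by linarith)]; linarith [hadm (u k) (u l), Real.pi_pos])
  apply Real.le_sqrt_of_sq_le
  have h2 : 2 / Real.pi ^ 2 * (dist (u k) (u l) / 2) ^ 2 ≤ K / (k + 1) := by linarith [h k l hkl]
  have hp : 0 < 2 * Real.pi ^ 2 := by positivity
  calc dist (u k) (u l) ^ 2
      = 2 * Real.pi ^ 2 * (2 / Real.pi ^ 2 * (dist (u k) (u l) / 2) ^ 2) := by
        field_simp
    _ ≤ _ := mul_le_mul_of_nonneg_left h2 hp.le

end
-- Existence of resolvents and their variational inequality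
section
variable {X : Type*} [MetricSpace X] {f : X → EReal}

theorem IsGammaZero.le_combination_coe (hf : IsGammaZero f) {x y p : X} {a A B : ℝ} (ha0 : 0 < a)
    (ha1 : a < 1) (h : IsCombination a x y p) (hA : f x = A) (hB : f y = B) :
    f p ≤ ((a * A + (1 - a) * B : ℝ) : EReal) := by
  have := hf.convex x y p a ha0 ha1 h
  rw [hA, hB] at this
  exact_mod_cast this

theorem IsGammaZero.exists_eq_coe_of_le (hf : IsGammaZero f) {p : X} {A : ℝ}
    (h : f p ≤ (A : EReal)) : ∃ P : ℝ, f p = P ∧ P ≤ A := by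
  lift f p to ℝ using ⟨(h.trans_lt (EReal.coe_lt_top _)).ne, hf.ne_bot p⟩ with P
  exact ⟨P, rfl, by exact_mod_cast h⟩

theorem IsGammaZero.exists_coe (hf : IsGammaZero f) : ∃ (a : X) (A : ℝ), f a = A := by
  obtain ⟨a, ha⟩ := hf.proper
  exact ⟨a, (f a).toReal, (EReal.coe_toReal ha (hf.ne_bot a)).symm⟩

/-- A proper lower semicontinuous convex function on an admissible space is bounded below. -/
theorem IsGammaZero.exists_lower_bound (hcat : IsCAT1 X) (hadm : IsAdmissible X)
    (hf : IsGammaZero f) : ∃ B : ℝ, ∀ (y : X) (Y : ℝ), f y = Y → B ≤ Y := by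
  obtain ⟨a, A, hA⟩ := hf.exists_coe
  have hlt : ((A - 1 : ℝ) : EReal) < f a := by
    rw [hA]; exact_mod_cast sub_one_lt A
  obtain ⟨δ, hδ, hball⟩ := Metric.eventually_nhds_iff.1 (hf.lowerSemicontinuous a _ hlt)
  replace hball : ∀ y : X, dist y a < δ → ((A - 1 : ℝ) : EReal) < f y := fun y hy => hball hy
  -- Outside the ball, the point at distance `δ / 2` from `a` towards `y` has weight `t ≥ δ / π` on
  -- `y`; convexity gives `t * (A - Y) < 1`, so `Y > A - π / δ`.
  refine ⟨A - 1 - Real.pi / δ, fun y Y hY => ?_⟩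
  have hq : 0 < Real.pi / δ := div_pos Real.pi_pos hδ
  by_cases hy : dist y a < δ
  · have := hball y hy
    rw [hY] at this
    have : A - 1 < Y := by exact_mod_cast this
    linarith
  rw [dist_comm, not_lt] at hy
  have hl : 0 < dist a y := hδ.trans_le hy
  set t := δ / 2 / dist a y with ht
  have ht0 : 0 < t := by positivity
  have ht1 : t < 1 := by rw [ht, div_lt_one hl]; linarith
  obtain ⟨p, hp⟩ := hcat.exists_combination hadm (1 - t) a y
  have hd := hp.dist_left ⟨by linarith, by linarith⟩
  rw [sub_sub_cancel, ht, div_mul_cancel₀ _ hl.ne'] at hd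
  have h1 := hball p (by rw [dist_comm, hd]; linarith)
  have h2 := hf.le_combination_coe (by linarith) (by linarith) hp hA hY
  have h3 : A - 1 < (1 - t) * A + (1 - (1 - t)) * Y := by exact_mod_cast h1.trans_le h2
  have h4 : 1 ≤ Real.pi / δ * t := by
    rw [ht]
    field_simp
    linarith [hadm a y]
  by_contra! hlt
  have : t * (A - Y) < 1 := by linarith
  nlinarith

theorem tan_mul_sin_eq {t : ℝ} (h : 0 < Real.cos t) :
    Real.tan t * Real.sin t = 1 / Real.cos t - Real.cos t := by
  rw [Real.tan_eq_sin_div_cos]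
  field_simp
  linarith [Real.sin_sq_add_cos_sq t]

theorem one_div_sub_self_le {u v : ℝ} (hu : 0 < u) (h : u ≤ v) : 1 / v - v ≤ 1 / u - u := by
  have := one_div_le_one_div_of_le hu h
  linarith

/-- The uniform convexity of `tan d sin d`. -/
theorem one_div_sub_self_midpoint {u v k w : ℝ} (hu : 0 < u) (hv : 0 < v) (hu1 : u ≤ 1)
    (hv1 : v ≤ 1) (hk : 0 < k) (hk1 : k ≤ 1) (h : u + v ≤ 2 * k * w) :
    1 / w - w ≤ ((1 / u - u) + (1 / v - v)) / 2 - (1 - k) := by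
  have hw : (u + v) / (2 * k) ≤ w := by rw [div_le_iff₀ (by positivity)]; linarith
  refine (one_div_sub_self_le (by positivity) hw).trans ?_
  have hm : 0 < u + v := by positivity
  -- The gain `1 - k` survives because `u + v ≤ 2`.
  have e1 : 1 / ((u + v) / (2 * k)) = 2 / (u + v) - (1 - k) * (2 / (u + v)) := by
    field_simp; ring
  have e2 : 2 / (u + v) ≤ (1 / u + 1 / v) / 2 := by
    have : (1 / u + 1 / v) / 2 = (u + v) / (2 * (u * v)) := by field_simp; ring
    rw [this, div_le_div_iff₀ hm (by positivity)]
    nlinarith [sq_nonneg (u - v)]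
  have e3 : 1 ≤ 2 / (u + v) := by rw [le_div_iff₀ hm]; linarith
  have e4 : (u + v) / 2 ≤ (u + v) / (2 * k) :=
    div_le_div_of_nonneg_left hm.le (by positivity) (by linarith)
  nlinarith

/-- Uniform convexity of the penalty makes minimizing sequences Cauchy, and lower semicontinuity
passes to the limit. Since `resolvent` is a choice, existence of a minimizer is all that is needed;
uniqueness plays no role. -/
theorem resolvent_mem_argmin [CompleteSpace X] (hcat : IsCAT1 X) (hadm : IsAdmissible X)
    (hf : IsGammaZero f) (x : X) :
    resolvent f x ∈
      argmin fun y => f y + ((Real.tan (dist y x) * Real.sin (dist y x) : ℝ) : EReal) := by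
  refine @Classical.epsilon_spec X (fun z => z ∈ argmin fun y =>
    f y + ((Real.tan (dist y x) * Real.sin (dist y x) : ℝ) : EReal)) ?_
  have hpen : ∀ y : X, Real.tan (dist y x) * Real.sin (dist y x) =
      1 / Real.cos (dist y x) - Real.cos (dist y x) := fun y => tan_mul_sin_eq (hadm.cos_pos y x)
  simp only [hpen]
  have hpen0 : ∀ y : X, 0 ≤ 1 / Real.cos (dist y x) - Real.cos (dist y x) := fun y => by
    have := one_div_sub_self_le (hadm.cos_pos y x) (Real.cos_le_one _)
    simpa using this
  obtain ⟨B, hB⟩ := hf.exists_lower_bound hcat hadm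
  obtain ⟨a, A, hA⟩ := hf.exists_coe
  -- Only points with finite `f` enter, so the infimum can be taken in `ℝ`.
  let T : Set ℝ := {r | ∃ (y : X) (Y : ℝ), f y = Y ∧
    r = Y + (1 / Real.cos (dist y x) - Real.cos (dist y x))}
  have hTne : T.Nonempty := ⟨_, a, A, hA, rfl⟩
  have hTbdd : BddBelow T := ⟨B, by
    rintro r ⟨y, Y, hY, rfl⟩
    linarith [hB y Y hY, hpen0 y]⟩
  set m := sInf T
  have hm : ∀ (y : X) (Y : ℝ), f y = Y →
      m ≤ Y + (1 / Real.cos (dist y x) - Real.cos (dist y x)) :=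
    fun y Y hY => csInf_le hTbdd ⟨y, Y, hY, rfl⟩
  have hex : ∀ n : ℕ, ∃ (y : X) (Y : ℝ), f y = Y ∧
      Y + (1 / Real.cos (dist y x) - Real.cos (dist y x)) < m + 1 / ((n : ℝ) + 1) := by
    intro n
    obtain ⟨r, ⟨y, Y, hY, rfl⟩, hr⟩ := exists_lt_of_csInf_lt hTne
      (show sInf T < m + 1 / ((n : ℝ) + 1) from lt_add_of_pos_right _ (by positivity))
    exact ⟨y, Y, hY, hr⟩
  choose y Y hY hlt using hex
  have hcau : CauchySeq y := by
    refine cauchySeq_of_cos_half_dist hadm (K := 1) fun k l hkl => ?_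
    obtain ⟨p, hp⟩ := hcat.exists_combination hadm (1 / 2) (y k) (y l)
    obtain ⟨P, hP, hPle⟩ := hf.exists_eq_coe_of_le
      (hf.le_combination_coe (by norm_num) (by norm_num) hp (hY k) (hY l))
    have hd := dist_nonneg (x := y k) (y := y l)
    have h1 := one_div_sub_self_midpoint (hadm.cos_pos (y k) x) (hadm.cos_pos (y l) x)
      (Real.cos_le_one _) (Real.cos_le_one _)
      (Real.cos_pos_of_mem_Ioo (x := dist (y k) (y l) / 2)
        ⟨by linarith [Real.pi_pos], by linarith [hadm (y k) (y l)]⟩)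
      (Real.cos_le_one _) (hp.midpoint_cos_dist hcat hadm x)
    have h2 := hm p P hP
    have h3 : 1 / ((l : ℝ) + 1) ≤ 1 / ((k : ℝ) + 1) :=
      one_div_le_one_div_of_le (by positivity) (by exact_mod_cast Nat.succ_le_succ hkl)
    linarith [hlt k, hlt l]
  obtain ⟨z, hz⟩ := cauchySeq_tendsto_of_complete hcau
  have hlim : Tendsto (fun n : ℕ => m + 1 / ((n : ℝ) + 1) -
      (1 / Real.cos (dist (y n) x) - Real.cos (dist (y n) x))) atTop
      (𝓝 (m + 0 - (1 / Real.cos (dist z x) - Real.cos (dist z x)))) := by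
    have hc : Tendsto (fun n => Real.cos (dist (y n) x)) atTop (𝓝 (Real.cos (dist z x))) :=
      (Real.continuous_cos.tendsto _).comp (hz.dist tendsto_const_nhds)
    exact (tendsto_const_nhds.add tendsto_one_div_add_atTop_nhds_zero_nat).sub
      ((tendsto_const_nhds.div hc (hadm.cos_pos z x).ne').sub hc)
  rw [add_zero] at hlim
  have hfz : f z ≤ ((m - (1 / Real.cos (dist z x) - Real.cos (dist z x)) : ℝ) : EReal) := by
    by_contra! hcon
    obtain ⟨t, ht1, ht2⟩ := EReal.lt_iff_exists_real_btwn.1 hcon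
    have hev := hz.eventually (hf.lowerSemicontinuous z _ ht2)
    have : t ≤ m - (1 / Real.cos (dist z x) - Real.cos (dist z x)) := by
      refine ge_of_tendsto hlim (hev.mono fun n hn => ?_)
      replace hn : (t : EReal) < f (y n) := hn
      rw [hY n] at hn
      have : t < Y n := by exact_mod_cast hn
      linarith [hlt n]
    exact absurd (lt_of_lt_of_le ht1 (by exact_mod_cast this)) (lt_irrefl _)
  obtain ⟨Z, hZ, hZle⟩ := hf.exists_eq_coe_of_le hfz
  refine ⟨z, fun w => ?_⟩
  rcases eq_or_ne (f w) ⊤ with hw | hw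
  · simp only [hw, EReal.top_add_coe, le_top]
  · have hW := (EReal.coe_toReal hw (hf.ne_bot w)).symm
    have := hm w _ hW
    simp only [hZ]
    rw [hW]
    norm_cast
    linarith

/-- The variational inequality for the resolvent. -/
theorem resolvent_inequality [CompleteSpace X] (hcat : IsCAT1 X) (hadm : IsAdmissible X)
    (hf : IsGammaZero f) (x y : X) {A B : ℝ} (hA : f (resolvent f x) = A) (hB : f y = B) :
    (A - B) * Real.sin (dist y (resolvent f x)) ≤
      (1 + 1 / Real.cos (dist (resolvent f x) x) ^ 2) * dist y (resolvent f x) *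
        (Real.cos (dist (resolvent f x) x) * Real.cos (dist y (resolvent f x)) -
          Real.cos (dist y x)) := by
  have hmin := resolvent_mem_argmin hcat hadm hf x
  set z := resolvent f x
  rcases (dist_nonneg (x := y) (y := z)).eq_or_lt with h0 | hD
  · simp [← h0]
  have hpi := Real.pi_pos
  have hsin : 0 < Real.sin (dist y z) :=
    Real.sin_pos_of_pos_of_lt_pi hD (by linarith [hadm y z])
  have hcz := hadm.cos_pos z x
  have hcy := hadm.cos_pos y x
  -- `C t` is the comparison lower bound for `cos d(p, x)` with `p = t y ⊕ (1 - t) z`. Minimality of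
  -- `z` and convexity give `t * (A - B) ≤ G t - G 0` for `G = 1 / C - C`; dividing by `t` and
  -- letting `t → 0` gives `A - B ≤ G' 0`.
  let C : ℝ → ℝ := fun t => (Real.cos (dist y x) * Real.sin (t * dist y z) +
    Real.cos (dist z x) * Real.sin ((1 - t) * dist y z)) / Real.sin (dist y z)
  have hC0 : C 0 = Real.cos (dist z x) := by
    simp only [C]; simp [hsin.ne']
  set C' := (Real.cos (dist y x) * dist y z -
    Real.cos (dist z x) * (Real.cos (dist y z) * dist y z)) / Real.sin (dist y z) with hC'
  have hC : HasDerivAt C C' 0 := by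
    have d1 : HasDerivAt (fun t : ℝ => Real.sin (t * dist y z))
        (Real.cos (0 * dist y z) * (1 * dist y z)) 0 :=
      ((hasDerivAt_id (0 : ℝ)).mul_const _).sin
    have d2 : HasDerivAt (fun t : ℝ => Real.sin ((1 - t) * dist y z))
        (Real.cos ((1 - 0) * dist y z) * (-1 * dist y z)) 0 :=
      (((hasDerivAt_id (0 : ℝ)).const_sub 1).mul_const _).sin
    have := ((d1.const_mul (Real.cos (dist y x))).add
      (d2.const_mul (Real.cos (dist z x)))).div_const (Real.sin (dist y z))
    refine this.congr_deriv ?_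
    rw [hC']
    simp only [zero_mul, sub_zero, one_mul, Real.cos_zero]
    ring
  have hG : HasDerivAt (fun t => 1 / C t - C t) (-C' / C 0 ^ 2 - C') 0 := by
    simp only [one_div]
    exact (hC.inv (by rw [hC0]; exact hcz.ne')).sub hC
  have hslope := hG.tendsto_slope_zero_right
  have hle : A - B ≤ -C' / C 0 ^ 2 - C' := by
    refine ge_of_tendsto hslope ?_
    filter_upwards [Ioo_mem_nhdsGT (show (0 : ℝ) < 1 from one_pos)] with t ht
    obtain ⟨p, hp⟩ := hcat.exists_combination hadm t y z
    have h1 := hp.cos_dist hcat hadm ⟨ht.1.le, ht.2.le⟩ x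
    have h2 : C t ≤ Real.cos (dist p x) := by
      simp only [C]; rwa [div_le_iff₀ hsin]
    have h3 : 0 < C t := by
      have s1 : 0 < Real.sin (t * dist y z) := Real.sin_pos_of_pos_of_lt_pi (mul_pos ht.1 hD)
        (by nlinarith [hadm y z, ht.2])
      have s2 : 0 < Real.sin ((1 - t) * dist y z) :=
        Real.sin_pos_of_pos_of_lt_pi (mul_pos (by linarith [ht.2]) hD)
          (by nlinarith [hadm y z, ht.1])
      simp only [C]; positivity
    have h4 := one_div_sub_self_le h3 h2
    obtain ⟨P, hP, hPle⟩ := hf.exists_eq_coe_of_le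
      (hf.le_combination_coe ht.1 ht.2 hp hB hA)
    have h5 := hmin p
    simp only [hP, hA, tan_mul_sin_eq hcz, tan_mul_sin_eq (hadm.cos_pos p x)] at h5
    have h6 : A + (1 / Real.cos (dist z x) - Real.cos (dist z x)) ≤
        P + (1 / Real.cos (dist p x) - Real.cos (dist p x)) := by exact_mod_cast h5
    rw [zero_add, hC0, smul_eq_mul, inv_mul_eq_div, le_div_iff₀ ht.1]
    linarith
  rw [hC0] at hle
  have e : (-C' / Real.cos (dist z x) ^ 2 - C') * Real.sin (dist y z) =
      (1 + 1 / Real.cos (dist z x) ^ 2) * dist y z *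
        (Real.cos (dist z x) * Real.cos (dist y z) - Real.cos (dist y x)) := by
    rw [hC']; field_simp; ring
  rw [← e]
  exact mul_le_mul_of_nonneg_right hle hsin.le

theorem IsGammaZero.resolvent_ne_top [CompleteSpace X] (hcat : IsCAT1 X) (hadm : IsAdmissible X)
    (hf : IsGammaZero f) (x : X) : f (resolvent f x) ≠ ⊤ := by
  obtain ⟨a, A, hA⟩ := hf.exists_coe
  have := resolvent_mem_argmin hcat hadm hf x a
  intro h
  simp only [h, hA, EReal.top_add_coe, top_le_iff] at this
  exact absurd this (by rw [← EReal.coe_add]; exact EReal.coe_ne_top _)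

/-- The left side of `resolvent_inequality` is nonnegative here, hence so is the last factor on the
right: by the spherical law of cosines, an obtuse angle at the resolvent. -/
theorem cos_dist_resolvent_le [CompleteSpace X] (hcat : IsCAT1 X) (hadm : IsAdmissible X)
    (hf : IsGammaZero f) (x y : X) (h : f y ≤ f (resolvent f x)) :
    Real.cos (dist y x) ≤
      Real.cos (dist (resolvent f x) x) * Real.cos (dist y (resolvent f x)) := by
  have hA := (EReal.coe_toReal (hf.resolvent_ne_top hcat hadm x) (hf.ne_bot _)).symm
  obtain ⟨B, hB, hBA⟩ := hf.exists_eq_coe_of_le (h.trans_eq hA)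
  have key := resolvent_inequality hcat hadm hf x y hA hB
  set z := resolvent f x
  rcases (dist_nonneg (x := y) (y := z)).eq_or_lt with h0 | hD
  · rw [dist_eq_zero.1 h0.symm]; simp
  have hsin : 0 < Real.sin (dist y z) :=
    Real.sin_pos_of_pos_of_lt_pi hD (by linarith [hadm y z, Real.pi_pos])
  have h1 := (mul_nonneg (sub_nonneg.2 hBA) hsin.le).trans key
  have hcz := hadm.cos_pos z x
  exact sub_nonneg.1 (nonneg_of_mul_nonneg_right h1 (by positivity))

theorem IsGammaZero.const_mul (hf : IsGammaZero f) {r : ℝ} (hr : 0 < r) :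
    IsGammaZero fun y => (r : EReal) * f y := by
  have hr' : (0 : EReal) < r := by exact_mod_cast hr
  have hmono : Monotone fun t : EReal => (r : EReal) * t :=
    fun a b h => mul_le_mul_of_nonneg_left h hr'.le
  refine ⟨fun x => ?_, ?_, ?_, fun x y p a ha0 ha1 h => ?_⟩
  · induction h : f x with
    | bot => exact absurd h (hf.ne_bot x)
    | coe A => exact EReal.coe_ne_bot (r * A)
    | top => rw [EReal.coe_mul_top_of_pos hr]; exact top_ne_bot
  · obtain ⟨a, A, hA⟩ := hf.exists_coe
    exact ⟨a, by rw [hA]; exact EReal.coe_ne_top (r * A)⟩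
  · refine Continuous.comp_lowerSemicontinuous (g := fun t : EReal => (r : EReal) * t) ?_
      hf.lowerSemicontinuous hmono
    refine continuous_iff_continuousAt.2 fun t => ?_
    exact (EReal.continuousAt_mul (p := ((r : EReal), t)) (Or.inl hr'.ne') (Or.inl hr'.ne')
      (Or.inl (EReal.coe_ne_bot _)) (Or.inl (EReal.coe_ne_top _))).comp
        (Continuous.prodMk_right _).continuousAt
  · refine (hmono (hf.convex x y p a ha0 ha1 h)).trans_eq ?_
    simp only
    rw [EReal.left_distrib_of_nonneg_of_ne_top hr'.le (EReal.coe_ne_top _), mul_left_comm,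
      mul_left_comm (r : EReal)]

end
-- Asymptotic centers as maximizers of `liminfCos`
section
variable {X : Type*} [MetricSpace X] {u v : ℕ → X}

/-- The lower limit of the cosines of the distances to a sequence; for admissible spaces it
determines the upper limit of the distances. -/
noncomputable def liminfCos (u : ℕ → X) (y : X) : ℝ :=
  liminf (fun n => Real.cos (dist y (u n))) atTop

theorem eventually_lt_cos {y : X} {c : ℝ} (h : c < liminfCos u y) :
    ∀ᶠ n in atTop, c < Real.cos (dist y (u n)) :=
  eventually_lt_of_lt_liminf h (isBoundedUnder_of ⟨-1, fun _ => Real.neg_one_le_cos _⟩)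

theorem le_liminfCos {y : X} {c : ℝ} (h : ∀ᶠ n in atTop, c ≤ Real.cos (dist y (u n))) :
    c ≤ liminfCos u y :=
  le_liminf_of_le
    (isBoundedUnder_of ⟨1, fun _ => Real.cos_le_one _⟩ :
      IsBoundedUnder (· ≤ ·) atTop _).isCoboundedUnder_ge h

theorem liminfCos_le_one (u : ℕ → X) (y : X) : liminfCos u y ≤ 1 := by
  by_contra! h
  obtain ⟨n, hn⟩ := (eventually_lt_cos h).exists
  exact absurd hn (Real.cos_le_one _).not_gt

theorem liminfCos_nonneg (hadm : IsAdmissible X) (u : ℕ → X) (y : X) : 0 ≤ liminfCos u y :=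
  le_liminfCos (Eventually.of_forall fun _ => (hadm.cos_pos _ _).le)

/-- `arccos` is continuous and antitone, so it exchanges the two limits. Hence minimizing the upper
limit of distances is maximizing `liminfCos`. -/
theorem limsup_edist_eq (hadm : IsAdmissible X) (u : ℕ → X) (y : X) :
    limsup (fun n => edist y (u n)) atTop = ENNReal.ofReal (Real.arccos (liminfCos u y)) := by
  have h := Antitone.map_liminf_of_continuousAt (F := (atTop : Filter ℕ))
    (f := fun t => ENNReal.ofReal (Real.arccos t))
    (fun a b hab => ENNReal.ofReal_le_ofReal (Real.antitone_arccos hab))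
    (fun n => Real.cos (dist y (u n)))
    (ENNReal.continuous_ofReal.comp Real.continuous_arccos).continuousAt
    (isBoundedUnder_of ⟨1, fun _ => Real.cos_le_one _⟩ :
      IsBoundedUnder (· ≤ ·) atTop _).isCoboundedUnder_ge
    (isBoundedUnder_of ⟨-1, fun _ => Real.neg_one_le_cos _⟩)
  rw [liminfCos, h]
  congr 1
  funext n
  rw [Function.comp_apply, Real.arccos_cos dist_nonneg
    (by linarith [hadm y (u n), Real.pi_pos]), edist_dist]

theorem mem_asymptoticCenter_iff (hadm : IsAdmissible X) {z : X} :
    z ∈ asymptoticCenter u ↔ ∀ y, liminfCos u y ≤ liminfCos u z := by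
  have h1 : z ∈ asymptoticCenter u ↔
      ∀ y, limsup (fun n => edist z (u n)) atTop ≤ limsup (fun n => edist y (u n)) atTop :=
    ⟨fun h y => (show _ = _ from h).trans_le (iInf_le _ y),
      fun h => le_antisymm (le_iInf h) (iInf_le _ z)⟩
  rw [h1]
  refine forall_congr' fun y => ?_
  rw [limsup_edist_eq hadm, limsup_edist_eq hadm,
    ENNReal.ofReal_le_ofReal_iff (Real.arccos_nonneg _)]
  exact Real.strictAntiOn_arccos.le_iff_ge
    ⟨by linarith [liminfCos_nonneg hadm u z], liminfCos_le_one u z⟩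
    ⟨by linarith [liminfCos_nonneg hadm u y], liminfCos_le_one u y⟩

theorem sphericallyBounded_iff (hadm : IsAdmissible X) :
    SphericallyBounded u ↔ ∃ y, 0 < liminfCos u y := by
  rw [SphericallyBounded, iInf_lt_iff]
  refine exists_congr fun y => ?_
  rw [limsup_edist_eq hadm, ENNReal.ofReal_lt_ofReal_iff (by linarith [Real.pi_pos]),
    Real.arccos_lt_pi_div_two]

theorem liminfCos_le_comp {φ : ℕ → ℕ} (hφ : Tendsto φ atTop atTop) (y : X) :
    liminfCos u y ≤ liminfCos (u ∘ φ) y :=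
  le_of_forall_lt fun c hc => by
    obtain ⟨d, hcd, hd⟩ := exists_between hc
    exact hcd.trans_le (le_liminfCos ((hφ.eventually (eventually_lt_cos hd)).mono fun _ h => h.le))

theorem eq_of_one_le_cos_dist (hadm : IsAdmissible X) {x y : X}
    (h : 1 ≤ Real.cos (dist x y)) : x = y := by
  by_contra hne
  have := Real.cos_lt_cos_of_nonneg_of_le_pi (x := 0) (y := dist x y) le_rfl
    (by linarith [hadm x y, Real.pi_pos]) (dist_pos.2 hne)
  rw [Real.cos_zero] at this
  linarith

theorem cos_dist_sub_le (x y w : X) :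
    Real.cos (dist x w) - dist x y ≤ Real.cos (dist y w) := by
  have h1 := Real.abs_cos_sub_cos_le (dist x w) (dist y w)
  have h2 := abs_dist_sub_le x y w
  linarith [(abs_le.1 (h1.trans h2)).2]

theorem liminfCos_sub_le (u : ℕ → X) (x y : X) : liminfCos u x - dist x y ≤ liminfCos u y :=
  le_of_forall_lt fun c hc => by
    obtain ⟨d, hcd, hd⟩ := exists_between hc
    refine hcd.trans_le (le_liminfCos ?_)
    filter_upwards [eventually_lt_cos (u := u) (y := x) (c := d + dist x y) (by linarith)] with n hn
    linarith [cos_dist_sub_le x y (u n)]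

theorem liminfCos_le_of_tendsto (h : Tendsto (fun n => dist (u n) (v n)) atTop (𝓝 0)) (y : X) :
    liminfCos u y ≤ liminfCos v y :=
  le_of_forall_lt fun c hc => by
    obtain ⟨d, hcd, hd⟩ := exists_between hc
    obtain ⟨e, hce, hed⟩ := exists_between hcd
    refine hce.trans_le (le_liminfCos ?_)
    filter_upwards [eventually_lt_cos hd, h.eventually_lt_const (sub_pos.2 hed)] with n h1 h2
    have := cos_dist_sub_le (u n) (v n) y
    rw [dist_comm _ y, dist_comm _ y] at this
    linarith

theorem liminfCos_midpoint (hcat : IsCAT1 X) (hadm : IsAdmissible X) {x y p : X}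
    (h : IsCombination (1 / 2) x y p) :
    liminfCos u x + liminfCos u y ≤ 2 * Real.cos (dist x y / 2) * liminfCos u p := by
  have hk : 0 < Real.cos (dist x y / 2) := Real.cos_pos_of_mem_Ioo
    ⟨by linarith [Real.pi_pos, dist_nonneg (x := x) (y := y)],
      by linarith [hadm x y, dist_nonneg (x := x) (y := y)]⟩
  refine le_of_forall_pos_le_add fun ε hε => ?_
  have : (liminfCos u x + liminfCos u y - ε) / (2 * Real.cos (dist x y / 2)) ≤
      liminfCos u p := by
    refine le_liminfCos ?_
    filter_upwards [eventually_lt_cos (sub_lt_self (liminfCos u x) (half_pos hε)),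
      eventually_lt_cos (sub_lt_self (liminfCos u y) (half_pos hε))] with n h1 h2
    rw [div_le_iff₀ (by positivity)]
    linarith [h.midpoint_cos_dist hcat hadm (u n)]
  rw [div_le_iff₀ (by positivity)] at this
  linarith

/-- At the midpoint of two distinct maximizers `liminfCos` would exceed its positive maximum. -/
theorem eq_of_forall_liminfCos_le (hcat : IsCAT1 X) (hadm : IsAdmissible X) {p q : X}
    (hpos : 0 < liminfCos u p) (hp : ∀ y, liminfCos u y ≤ liminfCos u p)
    (hq : ∀ y, liminfCos u y ≤ liminfCos u q) : p = q := by
  obtain ⟨m, hm⟩ := hcat.exists_combination hadm (1 / 2) p q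
  have h1 := liminfCos_midpoint (u := u) hcat hadm hm
  have h2 : liminfCos u p = liminfCos u q := le_antisymm (hq p) (hp q)
  have hd := dist_nonneg (x := p) (y := q)
  have hk : 0 < Real.cos (dist p q / 2) := Real.cos_pos_of_mem_Ioo
    ⟨by linarith [Real.pi_pos], by linarith [hadm p q]⟩
  have h3 : 1 ≤ Real.cos (dist p q / 2) := by
    by_contra! hlt
    nlinarith [hp m]
  by_contra hne
  have h4 := Real.cos_lt_cos_of_nonneg_of_le_pi (x := 0) (y := dist p q / 2) le_rfl
    (by linarith [hadm p q]) (half_pos (dist_pos.2 hne))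
  rw [Real.cos_zero] at h4
  linarith

theorem exists_forall_liminfCos_le [CompleteSpace X] (hcat : IsCAT1 X) (hadm : IsAdmissible X)
    {y₀ : X} (hpos : 0 < liminfCos u y₀) :
    ∃ p, 0 < liminfCos u p ∧ ∀ y, liminfCos u y ≤ liminfCos u p := by
  have hbdd : BddAbove (Set.range (liminfCos u)) :=
    ⟨1, by rintro _ ⟨y, rfl⟩; exact liminfCos_le_one u y⟩
  set M := sSup (Set.range (liminfCos u)) with hM
  have hle : ∀ y, liminfCos u y ≤ M := fun y => le_csSup hbdd ⟨y, rfl⟩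
  have hMpos : 0 < M := hpos.trans_le (hle y₀)
  have hex : ∀ n : ℕ, ∃ y, M - 1 / ((n : ℝ) + 1) < liminfCos u y := by
    intro n
    obtain ⟨_, ⟨y, rfl⟩, hy⟩ := exists_lt_of_lt_csSup (Set.range_nonempty_iff_nonempty.2 ⟨y₀⟩)
      (show M - 1 / ((n : ℝ) + 1) < sSup (Set.range (liminfCos u)) from
        sub_lt_self _ (by positivity))
    exact ⟨y, hy⟩
  choose y hy using hex
  have hcau : CauchySeq y := by
    -- The midpoint value is at most `M`, so `M - 1 / (k + 1) ≤ cos (d / 2) * M`; dividing by `M >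
    -- 0` gives the constant.
    refine cauchySeq_of_cos_half_dist hadm (K := 1 / M) fun k l hkl => ?_
    obtain ⟨p, hp⟩ := hcat.exists_combination hadm (1 / 2) (y k) (y l)
    have hd := dist_nonneg (x := y k) (y := y l)
    have hk : 0 < Real.cos (dist (y k) (y l) / 2) := Real.cos_pos_of_mem_Ioo
      ⟨by linarith [Real.pi_pos], by linarith [hadm (y k) (y l)]⟩
    have h1 := liminfCos_midpoint (u := u) hcat hadm hp
    have h3 : 1 / ((l : ℝ) + 1) ≤ 1 / ((k : ℝ) + 1) :=
      one_div_le_one_div_of_le (by positivity) (by exact_mod_cast Nat.succ_le_succ hkl)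
    have h4 : M - 1 / ((k : ℝ) + 1) ≤ Real.cos (dist (y k) (y l) / 2) * M := by
      nlinarith [hy k, hy l, hle p]
    rw [div_div, mul_comm, ← div_div, le_div_iff₀ hMpos]
    linarith
  obtain ⟨p, hp⟩ := cauchySeq_tendsto_of_complete hcau
  have hlim : Tendsto (fun n : ℕ => M - 1 / ((n : ℝ) + 1) - dist (y n) p) atTop
      (𝓝 (M - 0 - 0)) :=
    (tendsto_const_nhds.sub tendsto_one_div_add_atTop_nhds_zero_nat).sub
      (tendsto_iff_dist_tendsto_zero.1 hp)
  have hMp : M ≤ liminfCos u p := by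
    have := le_of_tendsto hlim (b := liminfCos u p) (Eventually.of_forall fun n => by
      linarith [hy n, liminfCos_sub_le u (y n) p])
    simpa using this
  exact ⟨p, hMpos.trans_le hMp, fun y => (hle y).trans hMp⟩

/-- Convexity of a set, in terms of geodesic combinations. -/
def IsGeodesicallyConvex (S : Set X) : Prop :=
  ∀ (x y p : X) (a : ℝ), x ∈ S → y ∈ S → 0 < a → a < 1 → IsCombination a x y p → p ∈ S

open Classical in
-- The resolvent of this function is the nearest point projection onto `S`.
theorem isGammaZero_indicator {S : Set X} (hne : S.Nonempty) (hcl : IsClosed S)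
    (hconv : IsGeodesicallyConvex S) :
    IsGammaZero fun y => if y ∈ S then (0 : EReal) else ⊤ := by
  refine ⟨fun x => ?_, ?_, ?_, fun x y p a ha0 ha1 h => ?_⟩
  · split_ifs <;> simp
  · obtain ⟨a, ha⟩ := hne
    exact ⟨a, by simp [ha]⟩
  · intro x t ht
    by_cases hx : x ∈ S
    · refine Eventually.of_forall fun y => lt_of_lt_of_le ht ?_
      simp only [hx, if_true]
      split_ifs <;> simp
    · filter_upwards [hcl.isOpen_compl.mem_nhds hx] with y hy
      simpa [hx, show y ∉ S from hy] using ht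
  · have ha1' : 0 < 1 - a := by linarith
    by_cases hx : x ∈ S
    · by_cases hy : y ∈ S
      · simp [hx, hy, hconv x y p a hx hy ha0 ha1 h]
      · simp only [hx, hy, if_true, if_false, EReal.coe_mul_top_of_pos ha1', mul_zero, zero_add,
          le_top]
    · by_cases hy : y ∈ S
      · simp [hx, hy, EReal.coe_mul_top_of_pos ha0]
      · simp only [hx, hy, if_false, EReal.coe_mul_top_of_pos ha0, EReal.coe_mul_top_of_pos ha1',
          EReal.top_add_top, le_top]

theorem exists_projection [CompleteSpace X] (hcat : IsCAT1 X) (hadm : IsAdmissible X) {S : Set X}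
    (hne : S.Nonempty) (hcl : IsClosed S) (hconv : IsGeodesicallyConvex S) (x : X) :
    ∃ q ∈ S, ∀ y ∈ S, Real.cos (dist y x) ≤ Real.cos (dist q x) * Real.cos (dist y q) := by
  classical
  have hg := isGammaZero_indicator hne hcl hconv
  have hq := hg.resolvent_ne_top hcat hadm x
  refine ⟨_, by simpa using hq, fun y hy => cos_dist_resolvent_le hcat hadm hg x y ?_⟩
  simp only [hy, if_true]
  split_ifs <;> simp

/-- The asymptotic center of a sequence that approaches a closed convex set lies in the set. -/
theorem mem_of_forall_liminfCos_le [CompleteSpace X] (hcat : IsCAT1 X) (hadm : IsAdmissible X)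
    {S : Set X} (hcl : IsClosed S) (hconv : IsGeodesicallyConvex S) {w : ℕ → X}
    (hw : ∀ᶠ n in atTop, w n ∈ S) (hwu : Tendsto (fun n => dist (w n) (u n)) atTop (𝓝 0))
    {p : X} (hpos : 0 < liminfCos u p) (hp : ∀ y, liminfCos u y ≤ liminfCos u p) : p ∈ S := by
  obtain ⟨q, hqS, hq⟩ := exists_projection hcat hadm
    (hw.exists.elim fun n hn => ⟨w n, hn⟩) hcl hconv p
  have hk := hadm.cos_pos q p
  have hk1 := Real.cos_le_one (dist q p)
  -- With `q` the projection of `p`, the obtuse angle inequality at `w n` passes to the limit. Since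
  -- `liminfCos u q ≤ liminfCos u p` and the latter is positive, `cos d(q, p) = 1`.
  have key : liminfCos u p ≤ Real.cos (dist q p) * liminfCos u q := by
    refine le_of_forall_pos_le_add fun ε hε => ?_
    have : (liminfCos u p - ε) / Real.cos (dist q p) ≤ liminfCos u q := by
      refine le_liminfCos ?_
      filter_upwards [hw, hwu.eventually_lt_const (show 0 < ε / 3 by positivity),
        eventually_lt_cos (sub_lt_self (liminfCos u p) (show 0 < ε / 3 by positivity))]
        with n h1 h2 h3
      rw [div_le_iff₀ hk]
      have h4 := hq (w n) h1
      have h5 := cos_dist_sub_le (u n) (w n) p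
      have h6 := cos_dist_sub_le (w n) (u n) q
      rw [dist_comm (u n) (w n), dist_comm (u n)] at h5
      rw [dist_comm (u n)] at h6
      have h7 := mul_le_mul_of_nonneg_left h6 hk.le
      nlinarith
    rw [div_le_iff₀ hk] at this
    linarith
  have h1 : 1 ≤ Real.cos (dist q p) := by
    by_contra! hlt
    nlinarith [hp q]
  rwa [← eq_of_one_le_cos_dist hadm h1]

end
-- The relaxed proximal point iteration
section
variable {X : Type*} [MetricSpace X] {f : X → EReal}

theorem IsGammaZero.isClosed_sublevel (hf : IsGammaZero f) (c : EReal) :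
    IsClosed {y | f y ≤ c} :=
  hf.lowerSemicontinuous.isClosed_preimage c

theorem IsGammaZero.isGeodesicallyConvex_sublevel (hf : IsGammaZero f) (c : EReal) :
    IsGeodesicallyConvex {y | f y ≤ c} := by
  intro x y p a hx hy ha0 ha1 h
  have h0 : (0 : EReal) ≤ a := by exact_mod_cast ha0.le
  have h1 : (0 : EReal) ≤ ((1 - a : ℝ) : EReal) := by exact_mod_cast (sub_pos.2 ha1).le
  refine ((hf.convex x y p a ha0 ha1 h).trans
    (add_le_add (mul_le_mul_of_nonneg_left hx h0) (mul_le_mul_of_nonneg_left hy h1))).trans ?_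
  rw [← EReal.right_distrib_of_nonneg h0 h1, ← EReal.coe_add, add_sub_cancel, EReal.coe_one,
    one_mul]

theorem tendsto_dist_zero_of_tendsto_cos (hadm : IsAdmissible X) {u v : ℕ → X}
    (h : Tendsto (fun n => Real.cos (dist (u n) (v n))) atTop (𝓝 1)) :
    Tendsto (fun n => dist (u n) (v n)) atTop (𝓝 0) := by
  have := (Real.continuous_arccos.tendsto 1).comp h
  rw [Real.arccos_one] at this
  refine this.congr fun n => ?_
  rw [Function.comp_apply, Real.arccos_cos dist_nonneg
    (by linarith [hadm (u n) (v n), Real.pi_pos])]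

/-- The sequences generated by the proximal point algorithm with relaxation. -/
structure IsProximalSequence (f : X → EReal) (α lam : ℕ → ℝ) (x z : ℕ → X) : Prop where
  mem_Ico : ∀ n, α n ∈ Set.Ico (0 : ℝ) 1
  pos : ∀ n, 0 < lam n
  eq_resolvent : ∀ n, z n = resolvent (fun y => (lam n : EReal) * f y) (x n)
  isCombination : ∀ n, IsCombination (α n) (x n) (z n) (x (n + 1))

namespace IsProximalSequence

variable {α lam : ℕ → ℝ} {x z : ℕ → X}

theorem combination_cos_dist_le (h : IsProximalSequence f α lam x z) (hcat : IsCAT1 X)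
    (hadm : IsAdmissible X) (y : X) (n : ℕ) :
    α n * Real.cos (dist y (x n)) + (1 - α n) * Real.cos (dist y (z n)) ≤
      Real.cos (dist y (x (n + 1))) := by
  have := (h.isCombination n).combination_cos_dist_le hcat hadm
    ⟨(h.mem_Ico n).1, (h.mem_Ico n).2.le⟩ y
  rwa [dist_comm _ y, dist_comm _ y, dist_comm _ y] at this

variable [CompleteSpace X]

theorem ne_top (h : IsProximalSequence f α lam x z) (hcat : IsCAT1 X) (hadm : IsAdmissible X)
    (hf : IsGammaZero f) (n : ℕ) : f (z n) ≠ ⊤ := by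
  intro ht
  apply (hf.const_mul (h.pos n)).resolvent_ne_top hcat hadm (x n)
  rw [← h.eq_resolvent n, ht, EReal.coe_mul_top_of_pos (h.pos n)]

theorem exists_eq_coe (h : IsProximalSequence f α lam x z) (hcat : IsCAT1 X)
    (hadm : IsAdmissible X) (hf : IsGammaZero f) (n : ℕ) : ∃ A : ℝ, f (z n) = A :=
  ⟨_, (EReal.coe_toReal (h.ne_top hcat hadm hf n) (hf.ne_bot _)).symm⟩

theorem cos_dist_le_mul (h : IsProximalSequence f α lam x z) (hcat : IsCAT1 X)
    (hadm : IsAdmissible X) (hf : IsGammaZero f) {y : X} {n : ℕ} (hy : f y ≤ f (z n)) :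
    Real.cos (dist y (x n)) ≤ Real.cos (dist (z n) (x n)) * Real.cos (dist y (z n)) := by
  have := cos_dist_resolvent_le hcat hadm (hf.const_mul (h.pos n)) (x n) y
  rw [← h.eq_resolvent n] at this
  exact this (mul_le_mul_of_nonneg_left hy (by exact_mod_cast (h.pos n).le))

theorem cos_dist_le (h : IsProximalSequence f α lam x z) (hcat : IsCAT1 X)
    (hadm : IsAdmissible X) (hf : IsGammaZero f) {y : X} {n : ℕ} (hy : f y ≤ f (z n)) :
    Real.cos (dist y (x n)) ≤ Real.cos (dist y (z n)) :=
  (h.cos_dist_le_mul hcat hadm hf hy).trans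
    (mul_le_of_le_one_left (hadm.cos_pos _ _).le (Real.cos_le_one _))

theorem cos_dist_le_succ (h : IsProximalSequence f α lam x z) (hcat : IsCAT1 X)
    (hadm : IsAdmissible X) (hf : IsGammaZero f) {y : X} {n : ℕ} (hy : f y ≤ f (z n)) :
    Real.cos (dist y (x n)) ≤ Real.cos (dist y (x (n + 1))) := by
  have h1 := h.cos_dist_le hcat hadm hf hy
  have h2 := h.combination_cos_dist_le hcat hadm y n
  have h3 := (h.mem_Ico n).2
  nlinarith

theorem inequality (h : IsProximalSequence f α lam x z) (hcat : IsCAT1 X)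
    (hadm : IsAdmissible X) (hf : IsGammaZero f) {y : X} {n : ℕ} {A B : ℝ} (hA : f (z n) = A)
    (hB : f y = B) :
    lam n * (A - B) * Real.sin (dist y (z n)) ≤
      (1 + 1 / Real.cos (dist (z n) (x n)) ^ 2) * dist y (z n) *
        (Real.cos (dist (z n) (x n)) * Real.cos (dist y (z n)) - Real.cos (dist y (x n))) := by
  have := resolvent_inequality hcat hadm (hf.const_mul (h.pos n)) (x n) y
    (A := lam n * A) (B := lam n * B)
  rw [← h.eq_resolvent n] at this
  rw [mul_sub]
  exact this (by rw [hA, EReal.coe_mul]) (by rw [hB, EReal.coe_mul])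

/-- One summand of the telescoping estimate. -/
theorem mul_le_cos_sub_cos (h : IsProximalSequence f α lam x z) (hcat : IsCAT1 X)
    (hadm : IsAdmissible X) (hf : IsGammaZero f) {s : ℝ} (hs : s < Real.pi / 2) {y : X} {n : ℕ}
    (hzx : dist (z n) (x n) ≤ s) {B c : ℝ} (hB : f y = B) (hBc : B < c)
    (hc : (c : EReal) ≤ f (z n)) :
    (1 - α n) * lam n * ((c - B) * (2 / Real.pi)) ≤
      (1 + 1 / Real.cos s ^ 2) * (Real.cos (dist y (x (n + 1))) - Real.cos (dist y (x n))) := by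
  have hpi := Real.pi_pos
  obtain ⟨A, hA⟩ := h.exists_eq_coe hcat hadm hf n
  have hcA : c ≤ A := by rw [hA] at hc; exact_mod_cast hc
  have hD : 0 < dist y (z n) := by
    refine dist_pos.2 fun e => ?_
    rw [e, hA] at hB
    have : A = B := by exact_mod_cast hB
    linarith
  have key := h.inequality hcat hadm hf hA hB
  have hlam := h.pos n
  have hcs : 0 < Real.cos s := Real.cos_pos_of_mem_Ioo
    ⟨by linarith [dist_nonneg (x := z n) (y := x n)], hs⟩
  have hcz := hadm.cos_pos (z n) (x n)
  have hcy := hadm.cos_pos y (z n)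
  -- Jordan's inequality `sin D ≥ 2 / π * D` lets `D = d(y, z n)` cancel from both sides.
  have hsin := Real.mul_le_sin hD.le (hadm y (z n)).le
  have hcc : Real.cos s ≤ Real.cos (dist (z n) (x n)) :=
    Real.cos_le_cos_of_nonneg_of_le_pi dist_nonneg (by linarith) hzx
  have hK : 1 + 1 / Real.cos (dist (z n) (x n)) ^ 2 ≤ 1 + 1 / Real.cos s ^ 2 := by
    gcongr
  set K := 1 + 1 / Real.cos (dist (z n) (x n)) ^ 2
  have hKpos : 0 < K := by positivity
  set E := Real.cos (dist (z n) (x n)) * Real.cos (dist y (z n)) - Real.cos (dist y (x n))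
  have h1 : lam n * ((c - B) * (2 / Real.pi)) ≤ K * E := by
    refine le_of_mul_le_mul_right ?_ hD
    calc lam n * ((c - B) * (2 / Real.pi)) * dist y (z n)
        = lam n * (c - B) * (2 / Real.pi * dist y (z n)) := by ring
      _ ≤ lam n * (A - B) * Real.sin (dist y (z n)) := by
          have : 0 < A - B := by linarith
          gcongr
      _ ≤ K * dist y (z n) * E := key
      _ = K * E * dist y (z n) := by ring
  have hlhs : 0 < lam n * ((c - B) * (2 / Real.pi)) := by
    have : 0 < c - B := by linarith
    positivity
  have hE : 0 < E := pos_of_mul_pos_right (hlhs.trans_le h1) hKpos.le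
  have hEle : E ≤ Real.cos (dist y (z n)) - Real.cos (dist y (x n)) :=
    sub_le_sub_right (mul_le_of_le_one_left hcy.le (Real.cos_le_one _)) _
  have hα : 0 < 1 - α n := sub_pos.2 (h.mem_Ico n).2
  have hstep := h.combination_cos_dist_le hcat hadm y n
  calc (1 - α n) * lam n * ((c - B) * (2 / Real.pi))
      = (1 - α n) * (lam n * ((c - B) * (2 / Real.pi))) := by ring
    _ ≤ (1 - α n) * ((1 + 1 / Real.cos s ^ 2) * E) := by
        refine mul_le_mul_of_nonneg_left (h1.trans ?_) hα.le
        exact mul_le_mul_of_nonneg_right hK hE.le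
    _ = (1 + 1 / Real.cos s ^ 2) * ((1 - α n) * E) := by ring
    _ ≤ _ := by
        refine mul_le_mul_of_nonneg_left ?_ (by positivity)
        have := mul_le_mul_of_nonneg_left hEle hα.le
        linarith

/-- The values of `f` along the resolvents get arbitrarily close to the infimum of `f`. -/
theorem frequently_lt (h : IsProximalSequence f α lam x z) (hcat : IsCAT1 X)
    (hadm : IsAdmissible X) (hf : IsGammaZero f)
    (hsum : Tendsto (fun N => ∑ n ∈ Finset.range N, (1 - α n) * lam n) atTop atTop)
    (hzx : (⨆ n, dist (z n) (x n)) < Real.pi / 2) {c : EReal} {y : X} (hy : f y < c) :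
    ∃ᶠ n in atTop, f (z n) < c := by
  -- A real level is needed for the gap `c' - B`, as `c` may be `⊤`.
  obtain ⟨c', hyc, hcc⟩ := EReal.lt_iff_exists_real_btwn.1 hy
  refine Frequently.mono ?_ fun _ (hn : f (z _) < c') => hn.trans hcc
  by_contra hcon
  rw [not_frequently, eventually_atTop] at hcon
  obtain ⟨N, hN⟩ := hcon
  obtain ⟨B, hB, -⟩ := hf.exists_eq_coe_of_le hyc.le
  have hBc : B < c' := by rw [hB] at hyc; exact_mod_cast hyc
  set s := ⨆ n, dist (z n) (x n)
  -- Admissibility keeps the real supremum from being the default value of an unbounded family.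
  have hbdd : BddAbove (Set.range fun n => dist (z n) (x n)) :=
    ⟨Real.pi / 2, by rintro _ ⟨n, rfl⟩; exact (hadm _ _).le⟩
  have hs : ∀ n, dist (z n) (x n) ≤ s := fun n => le_ciSup hbdd n
  set δ := (c' - B) * (2 / Real.pi) with hδ
  have hδ0 : 0 < δ := mul_pos (sub_pos.2 hBc) (div_pos two_pos Real.pi_pos)
  set K := 1 + 1 / Real.cos s ^ 2
  have hK : 0 < K := by positivity
  -- If `f (z n) ≥ c'` from `N` on, this difference never increases, which bounds the divergent
  -- sums.
  have hind : ∀ M, N ≤ M →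
      (∑ n ∈ Finset.range M, (1 - α n) * lam n) * δ - K * Real.cos (dist y (x M)) ≤
        (∑ n ∈ Finset.range N, (1 - α n) * lam n) * δ - K * Real.cos (dist y (x N)) := by
    intro M hM
    induction M, hM using Nat.le_induction with
    | base => exact le_rfl
    | succ M hM ih =>
      have := h.mul_le_cos_sub_cos hcat hadm hf hzx (hs M) hB hBc (not_lt.1 (hN M hM))
      rw [Finset.sum_range_succ, add_mul]
      linarith
  set C := (∑ n ∈ Finset.range N, (1 - α n) * lam n) * δ - K * Real.cos (dist y (x N))
  obtain ⟨M, hM, hNM⟩ := ((hsum.eventually_gt_atTop ((C + K) / δ)).and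
    (eventually_ge_atTop N)).exists
  rw [div_lt_iff₀ hδ0] at hM
  have h1 := hind M hNM
  have h2 := mul_le_of_le_one_right hK.le (Real.cos_le_one (dist y (x M)))
  linarith

theorem monotone_cos_dist (h : IsProximalSequence f α lam x z) (hcat : IsCAT1 X)
    (hadm : IsAdmissible X) (hf : IsGammaZero f) {v : X} (hv : v ∈ argmin f) :
    Monotone fun n => Real.cos (dist v (x n)) :=
  monotone_nat_of_le_succ fun _ => h.cos_dist_le_succ hcat hadm hf (hv _)

/-- For a minimizer `v`, both `cos d(v, z n)` and `cos d(z n, x n)` dominate `cos d(v, x n)`, hence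
`cos d(v, x 0) > 0`. -/
theorem bounded_of_argmin (h : IsProximalSequence f α lam x z) (hcat : IsCAT1 X)
    (hadm : IsAdmissible X) (hf : IsGammaZero f) (hne : (argmin f).Nonempty) :
    SphericallyBounded z ∧ (⨆ n, dist (z n) (x n)) < Real.pi / 2 := by
  obtain ⟨v, hv⟩ := hne
  have hc0 := hadm.cos_pos v (x 0)
  have hmono := h.monotone_cos_dist hcat hadm hf hv
  refine ⟨(sphericallyBounded_iff hadm).2 ⟨v, hc0.trans_le (le_liminfCos (Eventually.of_forall
    fun n => (hmono n.zero_le).trans (h.cos_dist_le hcat hadm hf (hv _))))⟩, ?_⟩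
  refine (ciSup_le fun n => ?_).trans_lt (Real.arccos_lt_pi_div_two.2 hc0)
  have h1 : Real.cos (dist v (x 0)) ≤ Real.cos (dist (z n) (x n)) :=
    ((hmono n.zero_le).trans (h.cos_dist_le_mul hcat hadm hf (hv _))).trans
      (mul_le_of_le_one_right (hadm.cos_pos _ _).le (Real.cos_le_one _))
  rw [← Real.arccos_cos (x := dist (z n) (x n)) dist_nonneg
    (by linarith [hadm (z n) (x n), Real.pi_pos])]
  exact Real.antitone_arccos h1

theorem argmin_nonempty (h : IsProximalSequence f α lam x z) (hcat : IsCAT1 X)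
    (hadm : IsAdmissible X) (hf : IsGammaZero f)
    (hsum : Tendsto (fun N => ∑ n ∈ Finset.range N, (1 - α n) * lam n) atTop atTop)
    (hbd : SphericallyBounded z) (hzx : (⨆ n, dist (z n) (x n)) < Real.pi / 2) :
    (argmin f).Nonempty := by
  obtain ⟨a, A, hA⟩ := hf.exists_coe
  have hm : (⨅ y, f y) < ⊤ := (iInf_le f a).trans_lt (by rw [hA]; exact EReal.coe_lt_top A)
  obtain ⟨c, -, hc, hclim⟩ := exists_seq_strictAnti_tendsto' hm
  obtain ⟨φ, hφ, hφc⟩ := extraction_forall_of_frequently (P := fun k n => f (z n) < c k)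
    fun k => by
      obtain ⟨y, hy⟩ := iInf_lt_iff.1 (hc k).1
      exact h.frequently_lt hcat hadm hf hsum hzx hy
  obtain ⟨y, hy⟩ := (sphericallyBounded_iff hadm).1 hbd
  obtain ⟨p, hpos, hp⟩ := exists_forall_liminfCos_le (u := z ∘ φ) hcat hadm
    (hy.trans_le (liminfCos_le_comp hφ.tendsto_atTop y))
  have hpm : ∀ d, (⨅ y, f y) < d → f p ≤ d := by
    intro d hd
    refine mem_of_forall_liminfCos_le hcat hadm (hf.isClosed_sublevel d)
      (hf.isGeodesicallyConvex_sublevel d) (w := z ∘ φ) ?_ (by simp) hpos hp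
    filter_upwards [hclim.eventually_lt_const hd] with k hk
    exact ((hφc k).trans hk).le
  exact ⟨p, fun y => (le_of_forall_gt_imp_ge_of_dense hpm).trans (iInf_le f y)⟩

theorem exists_tendsto_cos (h : IsProximalSequence f α lam x z) (hcat : IsCAT1 X)
    (hadm : IsAdmissible X) (hf : IsGammaZero f) {v : X} (hv : v ∈ argmin f) :
    ∃ L, 0 < L ∧ Tendsto (fun n => Real.cos (dist v (x n))) atTop (𝓝 L) := by
  have hmono := h.monotone_cos_dist hcat hadm hf hv
  have hbdd : BddAbove (Set.range fun n => Real.cos (dist v (x n))) :=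
    ⟨1, by rintro _ ⟨n, rfl⟩; exact Real.cos_le_one _⟩
  exact ⟨_, (hadm.cos_pos v (x 0)).trans_le (le_ciSup hbdd 0), tendsto_atTop_ciSup hmono hbdd⟩

/-- Since `1 - α n` stays away from 0, convergence of `cos d(v, x n)` to `L > 0` forces the same
limit for `cos d(v, z n)`, and `cos d(z n, x n)` is at least their ratio. -/
theorem tendsto_dist (h : IsProximalSequence f α lam x z) (hcat : IsCAT1 X)
    (hadm : IsAdmissible X) (hf : IsGammaZero f) (hne : (argmin f).Nonempty)
    (hα : (⨆ n, α n) < 1) : Tendsto (fun n => dist (z n) (x n)) atTop (𝓝 0) := by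
  obtain ⟨v, hv⟩ := hne
  obtain ⟨L, hL, hlim⟩ := h.exists_tendsto_cos hcat hadm hf hv
  have hbdd : BddAbove (Set.range α) := ⟨1, by rintro _ ⟨n, rfl⟩; exact (h.mem_Ico n).2.le⟩
  set a := ⨆ n, α n
  have hαa : ∀ n, α n ≤ a := fun n => le_ciSup hbdd n
  have ha : 0 < 1 - a := sub_pos.2 hα
  have hlim1 := (tendsto_add_atTop_iff_nat 1).2 hlim
  have hz : Tendsto (fun n => Real.cos (dist v (z n))) atTop (𝓝 L) := by
    have hup : Tendsto (fun n => Real.cos (dist v (x n)) +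
        (Real.cos (dist v (x (n + 1))) - Real.cos (dist v (x n))) / (1 - a)) atTop
        (𝓝 (L + (L - L) / (1 - a))) := hlim.add ((hlim1.sub hlim).div_const _)
    rw [sub_self, zero_div, add_zero] at hup
    refine tendsto_of_tendsto_of_tendsto_of_le_of_le hlim hup
      (fun n => h.cos_dist_le hcat hadm hf (hv _)) fun n => ?_
    have h1 := h.cos_dist_le hcat hadm hf (hv (z n))
    have h2 := h.combination_cos_dist_le hcat hadm v n
    have h3 := hαa n
    have h4 : Real.cos (dist v (z n)) - Real.cos (dist v (x n)) ≤
        (Real.cos (dist v (x (n + 1))) - Real.cos (dist v (x n))) / (1 - a) := by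
      rw [le_div_iff₀ ha]; nlinarith
    linarith
  refine tendsto_dist_zero_of_tendsto_cos hadm ?_
  have hq := hlim.div hz hL.ne'
  rw [div_self hL.ne'] at hq
  refine tendsto_of_tendsto_of_tendsto_of_le_of_le hq tendsto_const_nhds (fun n => ?_)
    fun n => Real.cos_le_one _
  rw [Pi.div_apply, div_le_iff₀ (hadm.cos_pos _ _)]
  exact h.cos_dist_le_mul hcat hadm hf (hv _)

/-- The iterates approach every sublevel set above the minimum: compare `x n` with the last
resolvent up to time `n` that lies in the sublevel set. -/
theorem exists_tendsto_sublevel (h : IsProximalSequence f α lam x z) (hcat : IsCAT1 X)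
    (hadm : IsAdmissible X) (hf : IsGammaZero f)
    (hzx : Tendsto (fun n => dist (z n) (x n)) atTop (𝓝 0)) {c : EReal}
    (hfreq : ∃ᶠ n in atTop, f (z n) < c) :
    ∃ w : ℕ → X, (∀ᶠ n in atTop, f (w n) ≤ c) ∧
      Tendsto (fun n => dist (w n) (x n)) atTop (𝓝 0) := by
  classical
  -- `m n` defaults to 0 before the first good index, so its property holds only eventually.
  set m : ℕ → ℕ := fun n => Nat.findGreatest (fun k => f (z k) ≤ c) n with hm
  have hmt : Tendsto m atTop atTop := by
    refine tendsto_atTop.2 fun N => ?_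
    obtain ⟨k, hk, hkc⟩ := frequently_atTop.1 hfreq N
    filter_upwards [eventually_ge_atTop k] with n hn
    exact hk.trans (Nat.le_findGreatest hn hkc.le)
  have hmc : ∀ᶠ n in atTop, f (z (m n)) ≤ c := by
    obtain ⟨k, hkc⟩ := hfreq.exists
    filter_upwards [eventually_ge_atTop k] with n hn
    exact Nat.findGreatest_spec (P := fun k => f (z k) ≤ c) hn hkc.le
  -- After the last good index `k` all later resolvents up to `n` have larger values than `z k`, so
  -- `z k` acts as a minimizer and the iterates do not move away from it.
  have hind : ∀ k n, k ≤ n → f (z k) ≤ c → (∀ j, k < j → j ≤ n → ¬ f (z j) ≤ c) →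
      Real.cos (dist (z k) (x k)) ≤ Real.cos (dist (z k) (x n)) := by
    intro k n hkn hk
    induction n, hkn using Nat.le_induction with
    | base => exact fun _ => le_rfl
    | succ n hn ih =>
      intro hj
      refine (ih fun j h1 h2 => hj j h1 (by omega)).trans (h.cos_dist_le_succ hcat hadm hf ?_)
      rcases hn.eq_or_lt with rfl | hlt
      · exact le_rfl
      · exact hk.trans (not_le.1 (hj n hlt (by omega))).le
  refine ⟨fun n => z (m n), hmc, tendsto_dist_zero_of_tendsto_cos hadm ?_⟩
  have hcos : Tendsto (fun n => Real.cos (dist (z (m n)) (x (m n)))) atTop (𝓝 1) := by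
    rw [← Real.cos_zero]
    exact (Real.continuous_cos.tendsto 0).comp (hzx.comp hmt)
  refine tendsto_of_tendsto_of_tendsto_of_le_of_le' hcos tendsto_const_nhds ?_
    (Eventually.of_forall fun n => Real.cos_le_one _)
  filter_upwards [hmc] with n hn
  exact hind (m n) n (Nat.findGreatest_le n) hn
    fun j h1 h2 => Nat.findGreatest_is_greatest h1 h2

theorem exists_deltaTendsto (h : IsProximalSequence f α lam x z) (hcat : IsCAT1 X)
    (hadm : IsAdmissible X) (hf : IsGammaZero f)
    (hsum : Tendsto (fun N => ∑ n ∈ Finset.range N, (1 - α n) * lam n) atTop atTop)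
    (hne : (argmin f).Nonempty) (hα : (⨆ n, α n) < 1) :
    ∃ p ∈ argmin f, DeltaTendsto x p ∧ DeltaTendsto z p := by
  have hzx := h.tendsto_dist hcat hadm hf hne hα
  have hsup := (h.bounded_of_argmin hcat hadm hf hne).2
  have hlev : ∀ v ∈ argmin f, ∀ φ : ℕ → ℕ, StrictMono φ →
      liminfCos (x ∘ φ) v = liminfCos x v ∧ 0 < liminfCos x v := by
    intro v hv φ hφ
    obtain ⟨L, hL, hlim⟩ := h.exists_tendsto_cos hcat hadm hf hv
    have e1 : liminfCos x v = L := hlim.liminf_eq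
    have e2 : liminfCos (x ∘ φ) v = L := (hlim.comp hφ.tendsto_atTop).liminf_eq
    exact ⟨e2.trans e1.symm, e1 ▸ hL⟩
  obtain ⟨v, hv⟩ := hne
  have hcenter : ∀ φ : ℕ → ℕ, StrictMono φ →
      ∃ p ∈ argmin f, ∀ y, liminfCos (x ∘ φ) y ≤ liminfCos (x ∘ φ) p := by
    intro φ hφ
    obtain ⟨e, hpos⟩ := hlev v hv φ hφ
    obtain ⟨p, hp0, hp⟩ := exists_forall_liminfCos_le (u := x ∘ φ) hcat hadm (e ▸ hpos)
    refine ⟨p, fun y => (le_of_forall_gt_imp_ge_of_dense fun d hd => ?_ : f p ≤ f v).trans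
      (hv y), hp⟩
    obtain ⟨w, hw, hwx⟩ := h.exists_tendsto_sublevel hcat hadm hf hzx
      (h.frequently_lt hcat hadm hf hsum hsup hd)
    exact mem_of_forall_liminfCos_le hcat hadm (hf.isClosed_sublevel d)
      (hf.isGeodesicallyConvex_sublevel d) (w := w ∘ φ) (hφ.tendsto_atTop.eventually hw)
      (hwx.comp hφ.tendsto_atTop) hp0 hp
  obtain ⟨p, hpm, hp⟩ := hcenter id strictMono_id
  rw [Function.comp_id] at hp
  have hpos := (hlev p hpm id strictMono_id).2
  have hx : DeltaTendsto x p := by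
    intro φ hφ
    obtain ⟨q, hqm, hq⟩ := hcenter φ hφ
    -- Both points lie in `argmin f`, where `liminfCos` of `x` and of `x ∘ φ` agree, so `q` also
    -- maximizes `liminfCos x`.
    have hqp : p = q := by
      refine eq_of_forall_liminfCos_le hcat hadm hpos hp fun y => (hp y).trans ?_
      rw [← (hlev p hpm φ hφ).1, ← (hlev q hqm φ hφ).1]
      exact hq p
    subst hqp
    ext y
    rw [mem_asymptoticCenter_iff hadm, Set.mem_singleton_iff]
    refine ⟨fun hy => ?_, fun hy => hy ▸ hq⟩
    exact (eq_of_forall_liminfCos_le hcat hadm ((hlev p hpm φ hφ).1 ▸ hpos) hq hy).symm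
  refine ⟨p, hpm, hx, fun φ hφ => ?_⟩
  rw [← hx φ hφ]
  have e : ∀ y, liminfCos (z ∘ φ) y = liminfCos (x ∘ φ) y := fun y =>
    le_antisymm (liminfCos_le_of_tendsto (hzx.comp hφ.tendsto_atTop) y)
      (liminfCos_le_of_tendsto (by
        simpa only [Function.comp_def, dist_comm] using hzx.comp hφ.tendsto_atTop) y)
  ext y
  simp only [mem_asymptoticCenter_iff hadm, e]

end IsProximalSequence
end
end CATOne

theorem theorem4p1 {X : Type*} [MetricSpace X] [CompleteSpace X]
    (hcat : CATOne.IsCAT1 X) (hadm : CATOne.IsAdmissible X)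
    (f : X → EReal) (hf : CATOne.IsGammaZero f)
    (α lam : ℕ → ℝ) (hα : ∀ n, α n ∈ Set.Ico (0 : ℝ) 1) (hlam : ∀ n, 0 < lam n)
    (hsum : Tendsto (fun N => ∑ n ∈ Finset.range N, (1 - α n) * lam n) atTop atTop)
    (x z : ℕ → X)
    (hz : ∀ n, z n = CATOne.resolvent (fun y => (lam n : EReal) * f y) (x n))
    (hx : ∀ n, CATOne.IsCombination (α n) (x n) (z n) (x (n + 1))) :
    ((CATOne.argmin f).Nonempty ↔
      CATOne.SphericallyBounded z ∧ (⨆ n, dist (z n) (x n)) < Real.pi / 2) ∧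
    ((CATOne.argmin f).Nonempty → (⨆ n, α n) < 1 →
      ∃ p ∈ CATOne.argmin f, CATOne.DeltaTendsto x p ∧ CATOne.DeltaTendsto z p) := by
  have h : CATOne.IsProximalSequence f α lam x z := ⟨hα, hlam, hz, hx⟩
  exact ⟨⟨h.bounded_of_argmin hcat hadm hf,
    fun hb => h.argmin_nonempty hcat hadm hf hsum hb.1 hb.2⟩,
    h.exists_deltaTendsto hcat hadm hf hsum⟩
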